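/- Let $\mathcal H$ be a complex Hilbert space and let $\mathbf T=(T_1,T_2)$ be a commuting pair of bounded linear operators on $\mathcal H$. Put $P:=\sqrt{T_1^*T_1+T_2^*T_2}$ and let $T_i=V_iP$ $(i=1,2)$ be the canonical joint polar decomposition of $\mathbf T$: the column operator $\binom{V_1}{V_2}:\mathcal H\to\mathcal H\oplus\mathcal H$ is a partial isometry and $\ker T_1\cap\ker T_2=\ker V_1\cap\ker V_2=\ker P$. Let $\widehat{\mathbf T}:=(\sqrt P\,V_1\sqrt P,\ \sqrt P\,V_2\sqrt P)$ be the spherical Aluthge transform of $\mathbf T$, which is again a commuting pair. For a commuting pair $\mathbf S=(S_1,S_2)$ on $\mathcal H$, the Koszul complex is $$0\longrightarrow\mathcal H\xrightarrow{\ \binom{S_1}{S_2}\ }\mathcal H\oplus\mathcal H\xrightarrow{\ (-S_2\ \ S_1)\ }\mathcal H\longrightarrow 0 .$$ Call $\mathbf S$ Fredholm if each map of this complex has closed range and its homology spaces $H^0,H^1,H^2$ are finite-dimensional; in that case let $\operatorname{ind}\mathbf S:=\dim H^0-\dim H^1+\dim H^2$. For $\lambda=(\lambda_1,\lambda_2)\in\mathbb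 C^2$ write $\mathbf S-\lambda:=(S_1-\lambda_1,S_2-\lambda_2)$, and let the Taylor essential spectrum be $$\sigma_{Te}(\mathbf S):=\{\lambda\in\mathbb C^2:\ \mathbf S-\lambda\text{ is not Fredholm}\}.$$ Then $$\sigma_{Te}(\mathbf T)=\sigma_{Te}(\widehat{\mathbf T}),$$ and for every $\lambda\notin\sigma_{Te}(\mathbf T)$, $$\operatorname{ind}(\mathbf T-\lambda)=\operatorname{ind}(\widehat{\mathbf T}-\lambda).$$ -/

import Mathlib

open ContinuousLinearMap

/-- A commuting pair of bounded operators on `H`. -/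
@[ext]
structure CommutingPair (H : Type*) [NormedAddCommGroup H] [InnerProductSpace ℂ H] where
  fst : H →L[ℂ] H
  snd : H →L[ℂ] H
  comm : fst * snd = snd * fst

namespace CommutingPair

section Koszul

variable {H : Type*} [NormedAddCommGroup H] [InnerProductSpace ℂ H]

/-- The pair `T - λ = (T₁ - λ₁, T₂ - λ₂)`. -/
def translate (T : CommutingPair H) (l : ℂ × ℂ) : CommutingPair H where
  fst := T.fst - l.1 • (1 : H →L[ℂ] H)
  snd := T.snd - l.2 • (1 : H →L[ℂ] H)
  comm := by
    have h := T.comm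
    simp only [sub_mul, mul_sub, smul_mul_assoc, mul_smul_comm, one_mul, mul_one, h, smul_sub,
      smul_comm l.2 l.1]
    abel

/-- First map `x ↦ (T₁ x, T₂ x)` of the Koszul complex `0 → H → H ⊕ H → H → 0`. -/
def d₀ (T : CommutingPair H) : H →L[ℂ] H × H := T.fst.prod T.snd

/-- Second map `(x, y) ↦ - T₂ x + T₁ y` of the Koszul complex `0 → H → H ⊕ H → H → 0`. -/
def d₁ (T : CommutingPair H) : H × H →L[ℂ] H := (-T.snd).coprod T.fst

theorem d₁_comp_d₀ (T : CommutingPair H) : T.d₁ ∘L T.d₀ = 0 := by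
  ext x
  have h := congrArg (fun A : H →L[ℂ] H => A x) T.comm
  simp only [mul_apply_eq_comp] at h
  simp [d₀, d₁, h]

/-- Homology of the Koszul complex at the left-hand `H`. -/
abbrev H₀ (T : CommutingPair H) : Type _ := LinearMap.ker (T.d₀ : H →ₗ[ℂ] H × H)

/-- Homology of the Koszul complex at `H ⊕ H`: the quotient `ker d₁ / ran d₀`. -/
abbrev H₁ (T : CommutingPair H) : Type _ :=
  LinearMap.ker (T.d₁ : H × H →ₗ[ℂ] H) ⧸
    (LinearMap.range (T.d₀ : H →ₗ[ℂ] H × H)).comap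
      (LinearMap.ker (T.d₁ : H × H →ₗ[ℂ] H)).subtype

/-- Homology of the Koszul complex at the right-hand `H`. -/
abbrev H₂ (T : CommutingPair H) : Type _ := H ⧸ LinearMap.range (T.d₁ : H × H →ₗ[ℂ] H)

/-- `T` is Fredholm: all maps of its Koszul complex have closed range and all the homology
quotients are finite-dimensional. -/
structure IsFredholm (T : CommutingPair H) : Prop where
  isClosed_range_d₀ : IsClosed (Set.range T.d₀)
  isClosed_range_d₁ : IsClosed (Set.range T.d₁)
  finite_H₀ : FiniteDimensional ℂ T.H₀
  finite_H₁ : FiniteDimensional ℂ T.H₁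
  finite_H₂ : FiniteDimensional ℂ T.H₂

/-- The Taylor essential spectrum. -/
def essentialSpectrum (T : CommutingPair H) : Set (ℂ × ℂ) :=
  {l | ¬ (T.translate l).IsFredholm}

/-- The Fredholm index: the Euler characteristic of the Koszul complex (meaningful when `T` is
Fredholm). -/
noncomputable def index (T : CommutingPair H) : ℤ :=
  (Module.finrank ℂ T.H₀ : ℤ) - Module.finrank ℂ T.H₁ + Module.finrank ℂ T.H₂

end Koszul

section Aluthge

variable {H : Type*} [NormedAddCommGroup H] [InnerProductSpace ℂ H] [CompleteSpace H]

/-- `P = √(T₁* T₁ + T₂* T₂)`. -/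
noncomputable def P (T : CommutingPair H) : H →L[ℂ] H :=
  CFC.sqrt (adjoint T.fst * T.fst + adjoint T.snd * T.snd)

/-- `√P`. -/
noncomputable def sqrtP (T : CommutingPair H) : H →L[ℂ] H := CFC.sqrt T.P

/-- `V` is the partial isometric part of the canonical joint polar decomposition `Tᵢ = Vᵢ P`:
the column `(V₁, V₂)` is a partial isometry (isometric on the orthogonal complement of its kernel)
and `ker T₁ ∩ ker T₂ = ker V₁ ∩ ker V₂ = ker P`. -/
structure IsCanonicalPolar (T : CommutingPair H) (V : (H →L[ℂ] H) × (H →L[ℂ] H)) : Prop where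
  fst_eq : T.fst = V.1 * T.P
  snd_eq : T.snd = V.2 * T.P
  isometric : ∀ x ∈ (V.1.ker ⊓ V.2.ker)ᗮ, ‖V.1 x‖ ^ 2 + ‖V.2 x‖ ^ 2 = ‖x‖ ^ 2
  ker_T : T.fst.ker ⊓ T.snd.ker = T.P.ker
  ker_V : V.1.ker ⊓ V.2.ker = T.P.ker

theorem P_isSelfAdjoint (T : CommutingPair H) : adjoint T.P = T.P :=
  (IsSelfAdjoint.of_nonneg (CFC.sqrt_nonneg _) : IsSelfAdjoint T.P)

theorem sqrtP_mul_sqrtP (T : CommutingPair H) : T.sqrtP * T.sqrtP = T.P :=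
  CFC.sqrt_mul_sqrt_self _ (CFC.sqrt_nonneg _)

theorem sqrtP_isSelfAdjoint (T : CommutingPair H) : adjoint T.sqrtP = T.sqrtP :=
  (IsSelfAdjoint.of_nonneg (CFC.sqrt_nonneg _) : IsSelfAdjoint T.sqrtP)

theorem P_mul_P (T : CommutingPair H) :
    T.P * T.P = adjoint T.fst * T.fst + adjoint T.snd * T.snd :=
  CFC.sqrt_mul_sqrt_self _ (add_nonneg (star_mul_self_nonneg T.fst) (star_mul_self_nonneg T.snd))

theorem norm_P_sq (T : CommutingPair H) (x : H) :
    ‖T.P x‖ ^ 2 = ‖T.fst x‖ ^ 2 + ‖T.snd x‖ ^ 2 := by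
  have h := congrArg (fun A : H →L[ℂ] H => RCLike.re (inner ℂ (A x) x)) T.P_mul_P
  have e : T.P * T.P = adjoint T.P * T.P := by rw [T.P_isSelfAdjoint]
  rw [e] at h
  simp only [mul_apply_eq_comp, add_apply, inner_add_left,
    map_add, ContinuousLinearMap.adjoint_inner_left, inner_self_eq_norm_sq] at h
  exact h

/-- Two operators that agree on the range and on the kernel of `P` are equal. -/
theorem eq_of_mul_P_eq (T : CommutingPair H) {A B : H →L[ℂ] H} (h : A * T.P = B * T.P)
    (hk : ∀ x, T.P x = 0 → A x = B x) : A = B := by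
  have hr : T.P.rangeᗮ = T.P.ker := by rw [orthogonal_range, P_isSelfAdjoint]
  have hcl : T.P.range.topologicalClosure ≤ (A - B).ker := by
    refine Submodule.topologicalClosure_minimal _ ?_ (A - B).isClosed_ker
    rintro _ ⟨x, rfl⟩
    have := congrArg (fun C : H →L[ℂ] H => C x) h
    simpa [sub_eq_zero] using this
  have hkl : T.P.range.topologicalClosureᗮ ≤ (A - B).ker := by
    rw [Submodule.orthogonal_closure, hr]
    intro x hx
    simpa [sub_eq_zero] using hk x hx
  have : CompleteSpace T.P.range.topologicalClosure :=
    (Submodule.isClosed_topologicalClosure _).completeSpace_coe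
  have htop : (⊤ : Submodule ℂ H) ≤ (A - B).ker := by
    rw [← Submodule.sup_orthogonal_of_hasOrthogonalProjection
      (K := T.P.range.topologicalClosure)]
    exact sup_le hcl hkl
  ext x
  simpa [sub_eq_zero] using htop (Submodule.mem_top (x := x))

/-- An operator dominated by `P` factors through `P`. -/
theorem exists_factor (T : CommutingPair H) (A : H →L[ℂ] H) (hA : ∀ x, ‖A x‖ ≤ ‖T.P x‖) :
    ∃ V : H →L[ℂ] H, A = V * T.P ∧ ∀ x, T.P x = 0 → V x = 0 := by
  let K := T.P.range.topologicalClosure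
  have : CompleteSpace K := (Submodule.isClosed_topologicalClosure _).completeSpace_coe
  have hmem : ∀ x, T.P x ∈ K := fun x =>
    Submodule.le_topologicalClosure _ (LinearMap.mem_range_self (T.P : H →ₗ[ℂ] H) x)
  let e : H →ₗ[ℂ] K := (T.P : H →ₗ[ℂ] H).codRestrict K hmem
  have hd : DenseRange e := by
    rw [DenseRange, Topology.IsEmbedding.subtypeVal.isInducing.dense_iff]
    rintro ⟨y, hy⟩
    rw [← Set.range_comp]
    exact hy
  have hn : ∃ C : ℝ, ∀ x, ‖(A : H →ₗ[ℂ] H) x‖ ≤ C * ‖e x‖ := ⟨1, fun x => by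
    simpa [e] using hA x⟩
  refine ⟨((A : H →ₗ[ℂ] H).extendOfNorm e) ∘L K.orthogonalProjectionOnto, ?_, ?_⟩
  · ext x
    have h1 := LinearMap.extendOfNorm_eq hd hn x
    have h2 : K.orthogonalProjectionOnto (T.P x) = e x :=
      Submodule.orthogonalProjectionOnto_mem_subspace_eq_self (K := K) (e x)
    simp only [mul_apply_eq_comp, ContinuousLinearMap.comp_apply, h2, h1]
    rfl
  · intro x hx
    have : x ∈ Kᗮ := by
      rw [Submodule.orthogonal_closure, orthogonal_range, P_isSelfAdjoint]
      exact hx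
    simp [Submodule.orthogonalProjectionOnto_apply_of_mem_orthogonal this]

/-- The canonical joint polar decomposition exists and is unique. -/
theorem existsUnique_polar (T : CommutingPair H) : ∃! V, T.IsCanonicalPolar V := by
  have hsq := T.norm_P_sq
  have hT : T.fst.ker ⊓ T.snd.ker = T.P.ker := by
    ext x
    have h := hsq x
    simp only [Submodule.mem_inf, LinearMap.mem_ker, ContinuousLinearMap.coe_coe]
    constructor
    · rintro ⟨h1, h2⟩
      simpa [h1, h2] using h
    · intro h0
      rw [h0, norm_zero] at h
      constructor <;> rw [← norm_eq_zero] <;>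
        nlinarith [sq_nonneg ‖T.fst x‖, sq_nonneg ‖T.snd x‖]
  obtain ⟨V₁, h₁, k₁⟩ := T.exists_factor T.fst fun x =>
    le_of_sq_le_sq (by nlinarith [hsq x, sq_nonneg ‖T.snd x‖]) (norm_nonneg _)
  obtain ⟨V₂, h₂, k₂⟩ := T.exists_factor T.snd fun x =>
    le_of_sq_le_sq (by nlinarith [hsq x, sq_nonneg ‖T.fst x‖]) (norm_nonneg _)
  have hiso : ∀ x ∈ T.P.kerᗮ, ‖V₁ x‖ ^ 2 + ‖V₂ x‖ ^ 2 = ‖x‖ ^ 2 := by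
    intro x hx
    rw [orthogonal_ker, P_isSelfAdjoint] at hx
    have hc : IsClosed {x : H | ‖V₁ x‖ ^ 2 + ‖V₂ x‖ ^ 2 = ‖x‖ ^ 2} :=
      isClosed_eq (by fun_prop) (by fun_prop)
    refine closure_minimal (s := (T.P.range : Set H)) ?_ hc hx
    rintro _ ⟨y, rfl⟩
    have e₁ : T.fst y = V₁ (T.P y) := congrArg (fun A : H →L[ℂ] H => A y) h₁
    have e₂ : T.snd y = V₂ (T.P y) := congrArg (fun A : H →L[ℂ] H => A y) h₂
    have := hsq y
    rw [e₁, e₂] at this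
    exact this.symm
  have hV : V₁.ker ⊓ V₂.ker = T.P.ker := by
    apply le_antisymm
    · rintro x ⟨hx₁, hx₂⟩
      rw [← hT]
      obtain ⟨u, hu, v, hv, rfl⟩ :=
        Submodule.exists_add_mem_mem_orthogonal (K := T.P.ker) x
      have a₁ : V₁ v = 0 := by simpa [k₁ u hu] using hx₁
      have a₂ : V₂ v = 0 := by simpa [k₂ u hu] using hx₂
      have := hiso v hv
      have hv0 : v = 0 := by simpa [a₁, a₂] using this.symm
      rw [hT, hv0, add_zero]
      exact hu
    · exact fun x hx => ⟨k₁ x hx, k₂ x hx⟩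
  refine ⟨(V₁, V₂), ⟨h₁, h₂, by rw [hV]; exact hiso, hT, hV⟩, ?_⟩
  rintro ⟨W₁, W₂⟩ hW
  have hz : ∀ x, T.P x = 0 → W₁ x = 0 ∧ W₂ x = 0 := fun x hx => by
    have : x ∈ W₁.ker ⊓ W₂.ker := hW.ker_V ▸ hx
    exact this
  refine Prod.ext (T.eq_of_mul_P_eq ?_ ?_) (T.eq_of_mul_P_eq ?_ ?_)
  · exact hW.fst_eq.symm.trans h₁
  · exact fun x hx => (hz x hx).1.trans (k₁ x hx).symm
  · exact hW.snd_eq.symm.trans h₂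
  · exact fun x hx => (hz x hx).2.trans (k₂ x hx).symm

/-- The pair `(V₁, V₂)` of the canonical joint polar decomposition. -/
noncomputable def polar (T : CommutingPair H) : (H →L[ℂ] H) × (H →L[ℂ] H) :=
  T.existsUnique_polar.exists.choose

theorem polar_spec (T : CommutingPair H) : T.IsCanonicalPolar T.polar :=
  T.existsUnique_polar.exists.choose_spec

theorem polar_comm (T : CommutingPair H) :
    T.polar.1 * T.P * T.polar.2 = T.polar.2 * T.P * T.polar.1 := by
  have h := T.polar_spec
  apply T.eq_of_mul_P_eq
  · rw [mul_assoc (_ * _), mul_assoc (_ * _), ← h.fst_eq, ← h.snd_eq]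
    exact T.comm
  · intro x hx
    have hk : x ∈ T.polar.1.ker ⊓ T.polar.2.ker := h.ker_V ▸ hx
    have h1 : T.polar.1 x = 0 := hk.1
    have h2 : T.polar.2 x = 0 := hk.2
    simp [h1, h2]

/-- The spherical Aluthge transform `(√P V₁ √P, √P V₂ √P)`, again a commuting pair. -/
noncomputable def sphericalAluthge (T : CommutingPair H) : CommutingPair H where
  fst := T.sqrtP * T.polar.1 * T.sqrtP
  snd := T.sqrtP * T.polar.2 * T.sqrtP
  comm := by
    have key : ∀ A B : H →L[ℂ] H, T.sqrtP * A * T.sqrtP * (T.sqrtP * B * T.sqrtP)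
        = T.sqrtP * (A * T.P * B) * T.sqrtP := fun A B => by
      rw [← T.sqrtP_mul_sqrtP]; simp only [mul_assoc]
    rw [key, key, T.polar_comm]

end Aluthge

end CommutingPair

/-! Write `Q = √P`. Then `Q Tᵢ = T̂ᵢ Q`, so `Q` is a morphism from the Koszul complex of `T - λ` to
that of `T̂ - λ`, and everything rests on the maps it induces on homology. If some `λᵢ ≠ 0`, put `A
= Vᵢ Q`. Since `V₁ P V₂ = V₂ P V₁`, `A` intertwines in the other direction, and `A Q = Tᵢ`, `Q A =
T̂ᵢ`. As `Tᵢ - λᵢ` and `T̂ᵢ - λᵢ` act as zero on the respective homologies, both composites act as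
the scalar `λᵢ`, so `Q` induces isomorphisms (`isFredholm_iff_of_intertwine_inverse`). If `λ = 0`,
the first Koszul maps of `T` and of `T̂` both factor through `Q` on the right. If either pair is
Fredholm, then `Q` has finite-dimensional kernel and closed range; being self-adjoint, it is
Fredholm (`isAlgFredholm_sqrtP`). A morphism of complexes with Fredholm components is Fredholm on
homology, and the Euler characteristic of its indices is the same on homology as on components: `ind
Q - 2 ind Q + ind Q = 0` (`algIndex_homology`). Closedness of ranges follows from finite-dimensional
homology, so the comparison is pure linear algebra. -/

namespace LinearMap

open Function

/-! ### Algebraic Fredholm maps and their index -/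

section Fredholm

variable {K : Type*} [Field K] {M N : Type*} [AddCommGroup M] [Module K M]
  [AddCommGroup N] [Module K N]

/-- A linear map is algebraically Fredholm if its kernel and cokernel are finite-dimensional. -/
structure IsAlgFredholm (f : M →ₗ[K] N) : Prop where
  finite_ker : FiniteDimensional K (ker f)
  finite_coker : FiniteDimensional K (N ⧸ range f)

/-- The index `dim ker f - dim coker f` of a linear map. -/
noncomputable def algIndex (f : M →ₗ[K] N) : ℤ :=
  (Module.finrank K (ker f) : ℤ) - Module.finrank K (N ⧸ range f)

theorem isAlgFredholm_of_bijective {f : M →ₗ[K] N} (hf : Bijective f) : f.IsAlgFredholm := by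
  have h₁ : ker f = ⊥ := ker_eq_bot.2 hf.1
  have h₂ : range f = ⊤ := range_eq_top.2 hf.2
  refine ⟨?_, ?_⟩
  · rw [h₁]; infer_instance
  · rw [h₂]; infer_instance

theorem algIndex_of_bijective {f : M →ₗ[K] N} (hf : Bijective f) : f.algIndex = 0 := by
  have h₁ : ker f = ⊥ := ker_eq_bot.2 hf.1
  have h₂ : range f = ⊤ := range_eq_top.2 hf.2
  rw [algIndex, h₁, h₂, finrank_bot, Module.finrank_zero_of_subsingleton, sub_self]

theorem IsAlgFredholm.finite_iff {f : M →ₗ[K] N} (hf : f.IsAlgFredholm) :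
    FiniteDimensional K M ↔ FiniteDimensional K N := by
  have := hf.finite_ker
  have := hf.finite_coker
  constructor
  · intro _
    exact Module.Finite.of_exact (f := (range f).subtype) (g := (range f).mkQ)
      (exact_subtype_mkQ _) (Submodule.mkQ_surjective _)
  · intro _
    exact Module.Finite.of_exact (f := (ker f).subtype) (g := f.rangeRestrict)
      (fun x => by simp [Subtype.ext_iff]) f.surjective_rangeRestrict

theorem algIndex_of_finiteDimensional (f : M →ₗ[K] N) [FiniteDimensional K M]
    [FiniteDimensional K N] :
    f.algIndex = (Module.finrank K M : ℤ) - Module.finrank K N := by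
  have h₁ := f.finrank_range_add_finrank_ker
  have h₂ := (range f).finrank_quotient_add_finrank
  rw [algIndex]
  omega

end Fredholm

/-! ### Dimension counts in exact sequences -/

section Exact

variable {K : Type*} [Field K] {V₁ V₂ V₃ V₄ V₅ V₆ : Type*}
  [AddCommGroup V₁] [Module K V₁] [AddCommGroup V₂] [Module K V₂] [AddCommGroup V₃] [Module K V₃]
  [AddCommGroup V₄] [Module K V₄] [AddCommGroup V₅] [Module K V₅] [AddCommGroup V₆] [Module K V₆]

/-- The middle term of a three-term exact sequence with finite-dimensional ends is
finite-dimensional. -/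
theorem finite_of_exact {f : V₁ →ₗ[K] V₂} {g : V₂ →ₗ[K] V₃} (h : Exact f g)
    [FiniteDimensional K V₁] [FiniteDimensional K V₃] : FiniteDimensional K V₂ :=
  Module.Finite.of_exact (f := f) (g := g.rangeRestrict)
    (fun x => by rw [← h x]; simp [Subtype.ext_iff]) g.surjective_rangeRestrict

theorem finrank_eq_of_exact {f : V₁ →ₗ[K] V₂} {g : V₂ →ₗ[K] V₃} (h : Exact f g)
    [FiniteDimensional K V₂] :
    Module.finrank K V₂ = Module.finrank K (range f) + Module.finrank K (range g) := by
  rw [← g.finrank_range_add_finrank_ker, h.linearMap_ker_eq, add_comm]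

/-- The alternating sum of dimensions of a six-term exact sequence vanishes. -/
theorem finrank_six_term {a : V₁ →ₗ[K] V₂} {b : V₂ →ₗ[K] V₃} {c : V₃ →ₗ[K] V₄}
    {d : V₄ →ₗ[K] V₅} {e : V₅ →ₗ[K] V₆} (ha : Injective a) (hab : Exact a b) (hbc : Exact b c)
    (hcd : Exact c d) (hde : Exact d e) (he : Surjective e)
    [FiniteDimensional K V₁] [FiniteDimensional K V₂] [FiniteDimensional K V₃]
    [FiniteDimensional K V₄] [FiniteDimensional K V₅] [FiniteDimensional K V₆] :
    (Module.finrank K V₂ : ℤ) - Module.finrank K V₅ =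
      (Module.finrank K V₁ - Module.finrank K V₄) +
        (Module.finrank K V₃ - Module.finrank K V₆) := by
  have h₁ := finrank_range_of_inj ha
  have h₂ := finrank_eq_of_exact hab
  have h₃ := finrank_eq_of_exact hbc
  have h₄ := finrank_eq_of_exact hcd
  have h₅ := finrank_eq_of_exact hde
  have h₆ : Module.finrank K (range e) = Module.finrank K V₆ := by
    rw [range_eq_top.2 he, finrank_top]
  omega

end Exact

/-! ### The snake lemma and additivity of the index -/

section Snake

variable {K : Type*} [Field K] {M₁ M₂ M₃ N₁ N₂ N₃ : Type*}
  [AddCommGroup M₁] [Module K M₁] [AddCommGroup M₂] [Module K M₂] [AddCommGroup M₃] [Module K M₃]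
  [AddCommGroup N₁] [Module K N₁] [AddCommGroup N₂] [Module K N₂] [AddCommGroup N₃] [Module K N₃]
  {i₁ : M₁ →ₗ[K] N₁} {i₂ : M₂ →ₗ[K] N₂} {i₃ : M₃ →ₗ[K] N₃}
  {f₁ : M₁ →ₗ[K] M₂} {f₂ : M₂ →ₗ[K] M₃} {g₁ : N₁ →ₗ[K] N₂} {g₂ : N₂ →ₗ[K] N₃}

/-- The six-term kernel-cokernel sequence of a morphism of short exact sequences. -/
theorem exists_snake_exact (hf₁ : Injective f₁) (hf : Exact f₁ f₂) (hf₂ : Surjective f₂)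
    (hg₁ : Injective g₁) (hg : Exact g₁ g₂) (hg₂ : Surjective g₂)
    (h₁ : g₁.comp i₁ = i₂.comp f₁) (h₂ : g₂.comp i₂ = i₃.comp f₂) :
    ∃ (a : ker i₁ →ₗ[K] ker i₂) (b : ker i₂ →ₗ[K] ker i₃) (c : ker i₃ →ₗ[K] N₁ ⧸ range i₁)
      (d : (N₁ ⧸ range i₁) →ₗ[K] N₂ ⧸ range i₂) (e : (N₂ ⧸ range i₂) →ₗ[K] N₃ ⧸ range i₃),
      Injective a ∧ Exact a b ∧ Exact b c ∧ Exact c d ∧ Exact d e ∧ Surjective e := by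
  have h₁' : ∀ x, g₁ (i₁ x) = i₂ (f₁ x) := fun x => congr($h₁ x)
  have h₂' : ∀ x, g₂ (i₂ x) = i₃ (f₂ x) := fun x => congr($h₂ x)
  let a : ker i₁ →ₗ[K] ker i₂ := f₁.restrict fun x hx => by
    rw [mem_ker] at hx ⊢; rw [← h₁', hx, map_zero]
  let b : ker i₂ →ₗ[K] ker i₃ := f₂.restrict fun x hx => by
    rw [mem_ker] at hx ⊢; rw [← h₂', hx, map_zero]
  let d : (N₁ ⧸ range i₁) →ₗ[K] N₂ ⧸ range i₂ := (range i₁).mapQ (range i₂) g₁ <| by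
    rintro _ ⟨x, rfl⟩; exact ⟨f₁ x, (h₁' x).symm⟩
  let e : (N₂ ⧸ range i₂) →ₗ[K] N₃ ⧸ range i₃ := (range i₂).mapQ (range i₃) g₂ <| by
    rintro _ ⟨x, rfl⟩; exact ⟨f₂ x, (h₂' x).symm⟩
  have hk₂ : Exact (ker i₂).subtype i₂ := fun x => by simp
  have hk₃ : Exact (ker i₃).subtype i₃ := fun x => by simp
  have hq₁ : Exact i₁ (range i₁).mkQ := fun x => by simp
  have hq₂ : Exact i₂ (range i₂).mkQ := fun x => by simp
  refine ⟨a, b, SnakeLemma.δ' i₁ i₂ i₃ f₁ f₂ hf g₁ g₂ hg h₁ h₂ (ker i₃).subtype hk₃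
    (range i₁).mkQ hq₁ hf₂ hg₁, d, e, ?_, ?_, ?_, ?_, ?_, ?_⟩
  · intro x y hxy
    exact Subtype.ext (hf₁ (congrArg Subtype.val hxy))
  · rintro ⟨x, hx⟩
    constructor
    · intro h
      obtain ⟨y, rfl⟩ := (hf x).1 (congrArg Subtype.val h)
      refine ⟨⟨y, hg₁ ?_⟩, rfl⟩
      rw [h₁', map_zero]; exact hx
    · rintro ⟨y, hy⟩
      refine Subtype.ext ((hf x).2 ⟨y, congrArg Subtype.val hy⟩)
  · exact SnakeLemma.exact_δ'_right i₁ i₂ i₃ f₁ f₂ hf g₁ g₂ hg h₁ h₂ (ker i₂).subtype hk₂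
      (ker i₃).subtype hk₃ (range i₁).mkQ hq₁ hf₂ hg₁ b rfl Subtype.val_injective
  · exact SnakeLemma.exact_δ'_left i₁ i₂ i₃ f₁ f₂ hf g₁ g₂ hg h₁ h₂
      (ker i₃).subtype hk₃ (range i₁).mkQ hq₁ (range i₂).mkQ hq₂ hf₂ hg₁ d
      (Submodule.mapQ_mkQ _ _ _ ) (Submodule.mkQ_surjective _)
  · intro y
    obtain ⟨y, rfl⟩ := Submodule.mkQ_surjective _ y
    constructor
    · intro h
      obtain ⟨x, hx⟩ : g₂ y ∈ range i₃ := (Submodule.Quotient.mk_eq_zero _).1 h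
      obtain ⟨x, rfl⟩ := hf₂ x
      obtain ⟨z, hz⟩ := (hg (y - i₂ x)).1 (by rw [map_sub, h₂', hx, sub_self])
      refine ⟨(range i₁).mkQ z, (Submodule.Quotient.eq _).2 ⟨-x, ?_⟩⟩
      rw [hz, map_neg]; abel
    · rintro ⟨x, hx⟩
      obtain ⟨x, rfl⟩ := Submodule.mkQ_surjective _ x
      rw [← hx]
      refine (Submodule.Quotient.mk_eq_zero _).2 ?_
      rw [hg.apply_apply_eq_zero]
      exact zero_mem _
  · intro y
    obtain ⟨y, rfl⟩ := Submodule.mkQ_surjective _ y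
    obtain ⟨y, rfl⟩ := hg₂ y
    exact ⟨(range i₂).mkQ y, rfl⟩

/-- In the six-term kernel-cokernel sequence each term of the third map lies between
finite-dimensional ones (or is a quotient of one), and the alternating sum of dimensions is the
index formula. The two variants below use the same sequence. -/
theorem IsAlgFredholm.right_of_shortExact (hf₁ : Injective f₁) (hf : Exact f₁ f₂)
    (hf₂ : Surjective f₂) (hg₁ : Injective g₁) (hg : Exact g₁ g₂) (hg₂ : Surjective g₂)
    (h₁ : g₁.comp i₁ = i₂.comp f₁) (h₂ : g₂.comp i₂ = i₃.comp f₂)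
    (H₁ : i₁.IsAlgFredholm) (H₂ : i₂.IsAlgFredholm) :
    i₃.IsAlgFredholm ∧ i₂.algIndex = i₁.algIndex + i₃.algIndex := by
  obtain ⟨a, b, c, d, e, ha, hab, hbc, hcd, hde, he⟩ :=
    exists_snake_exact hf₁ hf hf₂ hg₁ hg hg₂ h₁ h₂
  have := H₁.finite_ker
  have := H₁.finite_coker
  have := H₂.finite_ker
  have := H₂.finite_coker
  have := finite_of_exact hbc
  have := Module.Finite.of_surjective e he
  exact ⟨⟨‹_›, ‹_›⟩, finrank_six_term ha hab hbc hcd hde he⟩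

theorem IsAlgFredholm.left_of_shortExact (hf₁ : Injective f₁) (hf : Exact f₁ f₂)
    (hf₂ : Surjective f₂) (hg₁ : Injective g₁) (hg : Exact g₁ g₂) (hg₂ : Surjective g₂)
    (h₁ : g₁.comp i₁ = i₂.comp f₁) (h₂ : g₂.comp i₂ = i₃.comp f₂)
    (H₂ : i₂.IsAlgFredholm) (H₃ : i₃.IsAlgFredholm) :
    i₁.IsAlgFredholm ∧ i₂.algIndex = i₁.algIndex + i₃.algIndex := by
  obtain ⟨a, b, c, d, e, ha, hab, hbc, hcd, hde, he⟩ :=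
    exists_snake_exact hf₁ hf hf₂ hg₁ hg hg₂ h₁ h₂
  have := H₂.finite_ker
  have := H₂.finite_coker
  have := H₃.finite_ker
  have := H₃.finite_coker
  have := finite_of_exact hcd
  have := FiniteDimensional.of_injective a ha
  exact ⟨⟨‹_›, ‹_›⟩, finrank_six_term ha hab hbc hcd hde he⟩

theorem IsAlgFredholm.middle_of_shortExact (hf₁ : Injective f₁) (hf : Exact f₁ f₂)
    (hf₂ : Surjective f₂) (hg₁ : Injective g₁) (hg : Exact g₁ g₂) (hg₂ : Surjective g₂)
    (h₁ : g₁.comp i₁ = i₂.comp f₁) (h₂ : g₂.comp i₂ = i₃.comp f₂)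
    (H₁ : i₁.IsAlgFredholm) (H₃ : i₃.IsAlgFredholm) :
    i₂.IsAlgFredholm ∧ i₂.algIndex = i₁.algIndex + i₃.algIndex := by
  obtain ⟨a, b, c, d, e, ha, hab, hbc, hcd, hde, he⟩ :=
    exists_snake_exact hf₁ hf hf₂ hg₁ hg hg₂ h₁ h₂
  have := H₁.finite_ker
  have := H₁.finite_coker
  have := H₃.finite_ker
  have := H₃.finite_coker
  have := finite_of_exact hab
  have := finite_of_exact hde
  exact ⟨⟨‹_›, ‹_›⟩, finrank_six_term ha hab hbc hcd hde he⟩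

theorem IsAlgFredholm.prodMap_self {f : M₁ →ₗ[K] N₁} (hf : f.IsAlgFredholm) :
    (f.prodMap f).IsAlgFredholm ∧ (f.prodMap f).algIndex = f.algIndex + f.algIndex :=
  IsAlgFredholm.middle_of_shortExact (f₁ := inl K M₁ M₁) (f₂ := snd K M₁ M₁)
    (g₁ := inl K N₁ N₁) (g₂ := snd K N₁ N₁) inl_injective Exact.inl_snd snd_surjective
    inl_injective Exact.inl_snd snd_surjective (by ext <;> simp) (by ext <;> simp) hf hf

end Snake

end LinearMap

namespace LinearMap

open Function

/-! ### Fredholm morphisms of three-term complexes -/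

section Complex

variable {K : Type*} [Field K] {A B C A' B' C' : Type*}
  [AddCommGroup A] [Module K A] [AddCommGroup B] [Module K B] [AddCommGroup C] [Module K C]
  [AddCommGroup A'] [Module K A'] [AddCommGroup B'] [Module K B'] [AddCommGroup C'] [Module K C']
  {d₀ : A →ₗ[K] B} {d₁ : B →ₗ[K] C} {d₀' : A' →ₗ[K] B'} {d₁' : B' →ₗ[K] C'}
  {f₀ : A →ₗ[K] A'} {f₁ : B →ₗ[K] B'} {f₂ : C →ₗ[K] C'}

/-- The map between kernels induced by a commutative square. -/
def mapKer (h : f₁ ∘ₗ d₀ = d₀' ∘ₗ f₀) : ker d₀ →ₗ[K] ker d₀' :=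
  f₀.restrict fun x hx => by
    have := congr($h x)
    simp only [coe_comp, Function.comp_apply, mem_ker.1 hx, map_zero] at this
    exact this.symm

/-- The map between ranges induced by a commutative square. -/
def mapRange (h : f₁ ∘ₗ d₀ = d₀' ∘ₗ f₀) : range d₀ →ₗ[K] range d₀' :=
  f₁.restrict fun x hx => by
    obtain ⟨y, rfl⟩ := hx
    exact ⟨f₀ y, congr($h y).symm⟩

/-- The map between cokernels induced by a commutative square. -/
def mapCoker (h : f₁ ∘ₗ d₀ = d₀' ∘ₗ f₀) : (B ⧸ range d₀) →ₗ[K] B' ⧸ range d₀' :=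
  (range d₀).mapQ (range d₀') f₁ fun x hx => by
    obtain ⟨y, rfl⟩ := hx
    exact ⟨f₀ y, congr($h y).symm⟩

/-- The map on middle homology induced by a morphism of three-term complexes. -/
def mapHomology (h₀ : f₁ ∘ₗ d₀ = d₀' ∘ₗ f₀) (h₁ : f₂ ∘ₗ d₁ = d₁' ∘ₗ f₁) :
    (ker d₁ ⧸ (range d₀).comap (ker d₁).subtype) →ₗ[K]
      ker d₁' ⧸ (range d₀').comap (ker d₁').subtype :=
  Submodule.mapQ _ _ (mapKer h₁) fun x hx => by
    obtain ⟨y, hy⟩ := hx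
    refine ⟨f₀ y, ?_⟩
    have := congr($h₀ y)
    simp only [coe_comp, Function.comp_apply, hy] at this
    exact this.symm

/-- The kernel embeds in `ker f₁`, and the cokernel is a quotient of that of `f₀`. This is the entry
point for two-out-of-three arguments on kernels, cokernels and homology. -/
theorem isAlgFredholm_mapRange (h : f₁ ∘ₗ d₀ = d₀' ∘ₗ f₀) (H₀ : f₀.IsAlgFredholm)
    (H₁ : f₁.IsAlgFredholm) : (mapRange h).IsAlgFredholm := by
  have := H₁.finite_ker
  have := H₀.finite_coker
  constructor
  · let u : ker (mapRange h) →ₗ[K] ker f₁ :=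
      ((range d₀).subtype ∘ₗ (ker (mapRange h)).subtype).codRestrict _ fun x =>
        congrArg Subtype.val (mem_ker.1 x.2)
    exact FiniteDimensional.of_injective u fun x y hxy =>
      Subtype.ext (Subtype.ext (congrArg (Subtype.val : ker f₁ → B) hxy))
  · let u : (A' ⧸ range f₀) →ₗ[K] range d₀' ⧸ range (mapRange h) :=
      (range f₀).mapQ _ d₀'.rangeRestrict fun x hx => by
        obtain ⟨y, rfl⟩ := hx
        exact ⟨d₀.rangeRestrict y, Subtype.ext congr($h y)⟩
    refine Module.Finite.of_surjective u fun y => ?_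
    obtain ⟨⟨_, x, rfl⟩, rfl⟩ := Submodule.mkQ_surjective _ y
    exact ⟨(range f₀).mkQ x, rfl⟩

/-- Two out of three on `0 → ker d₀ → A → range d₀ → 0`. -/
theorem isAlgFredholm_mapKer (h : f₁ ∘ₗ d₀ = d₀' ∘ₗ f₀) (H₀ : f₀.IsAlgFredholm)
    (H₁ : f₁.IsAlgFredholm) : (mapKer h).IsAlgFredholm ∧
      f₀.algIndex = (mapKer h).algIndex + (mapRange h).algIndex :=
  IsAlgFredholm.left_of_shortExact (f₁ := (ker d₀).subtype) (f₂ := d₀.rangeRestrict)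
    (g₁ := (ker d₀').subtype) (g₂ := d₀'.rangeRestrict)
    Subtype.val_injective (fun x => by simp [Subtype.ext_iff]) d₀.surjective_rangeRestrict
    Subtype.val_injective (fun x => by simp [Subtype.ext_iff]) d₀'.surjective_rangeRestrict
    rfl (LinearMap.ext fun x => Subtype.ext congr($h x).symm) H₀ (isAlgFredholm_mapRange h H₀ H₁)

theorem isAlgFredholm_mapCoker (h : f₁ ∘ₗ d₀ = d₀' ∘ₗ f₀) (H₀ : f₀.IsAlgFredholm)
    (H₁ : f₁.IsAlgFredholm) : (mapCoker h).IsAlgFredholm ∧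
      f₁.algIndex = (mapRange h).algIndex + (mapCoker h).algIndex :=
  IsAlgFredholm.right_of_shortExact (f₁ := (range d₀).subtype) (f₂ := (range d₀).mkQ)
    (g₁ := (range d₀').subtype) (g₂ := (range d₀').mkQ)
    Subtype.val_injective (exact_subtype_mkQ _) (Submodule.mkQ_surjective _)
    Subtype.val_injective (exact_subtype_mkQ _) (Submodule.mkQ_surjective _)
    rfl rfl (isAlgFredholm_mapRange h H₀ H₁) H₁

/-- Two out of three on `0 → range d₀ → ker d₁ → ker d₁ / range d₀ → 0`. -/
theorem isAlgFredholm_mapHomology (h₀ : f₁ ∘ₗ d₀ = d₀' ∘ₗ f₀) (h₁ : f₂ ∘ₗ d₁ = d₁' ∘ₗ f₁)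
    (hd : d₁ ∘ₗ d₀ = 0) (hd' : d₁' ∘ₗ d₀' = 0) (H₀ : f₀.IsAlgFredholm) (H₁ : f₁.IsAlgFredholm)
    (H₂ : f₂.IsAlgFredholm) : (mapHomology h₀ h₁).IsAlgFredholm ∧
      (mapKer h₁).algIndex = (mapRange h₀).algIndex + (mapHomology h₀ h₁).algIndex := by
  have hle : range d₀ ≤ ker d₁ := range_le_ker_iff.2 hd
  have hle' : range d₀' ≤ ker d₁' := range_le_ker_iff.2 hd'
  have exact_incl : ∀ {p q : Submodule K B} (hpq : p ≤ q),
      Exact (Submodule.inclusion hpq) (p.comap q.subtype).mkQ := fun hpq x => by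
    simp [Subtype.ext_iff]
  have exact_incl' : ∀ {p q : Submodule K B'} (hpq : p ≤ q),
      Exact (Submodule.inclusion hpq) (p.comap q.subtype).mkQ := fun hpq x => by
    simp [Subtype.ext_iff]
  exact IsAlgFredholm.right_of_shortExact (f₁ := Submodule.inclusion hle)
    (f₂ := ((range d₀).comap (ker d₁).subtype).mkQ) (g₁ := Submodule.inclusion hle')
    (g₂ := ((range d₀').comap (ker d₁').subtype).mkQ)
    (Submodule.inclusion_injective _) (exact_incl hle) (Submodule.mkQ_surjective _)
    (Submodule.inclusion_injective _) (exact_incl' hle') (Submodule.mkQ_surjective _)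
    rfl rfl (isAlgFredholm_mapRange h₀ H₀ H₁) (isAlgFredholm_mapKer h₁ H₁ H₂).1

/-- The Euler characteristic of the indices on homology equals that of the components. -/
theorem algIndex_homology (h₀ : f₁ ∘ₗ d₀ = d₀' ∘ₗ f₀) (h₁ : f₂ ∘ₗ d₁ = d₁' ∘ₗ f₁)
    (hd : d₁ ∘ₗ d₀ = 0) (hd' : d₁' ∘ₗ d₀' = 0) (H₀ : f₀.IsAlgFredholm) (H₁ : f₁.IsAlgFredholm)
    (H₂ : f₂.IsAlgFredholm) :
    (mapKer h₀).algIndex - (mapHomology h₀ h₁).algIndex + (mapCoker h₁).algIndex =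
      f₀.algIndex - f₁.algIndex + f₂.algIndex := by
  have e₁ := (isAlgFredholm_mapKer h₀ H₀ H₁).2
  have e₂ := (isAlgFredholm_mapKer h₁ H₁ H₂).2
  have e₃ := (isAlgFredholm_mapCoker h₁ H₁ H₂).2
  have e₄ := (isAlgFredholm_mapHomology h₀ h₁ hd hd' H₀ H₁ H₂).2
  omega

/-! ### Morphisms inverse to each other on homology up to a nonzero scalar -/

variable {g₀ : A' →ₗ[K] A} {g₁ : B' →ₗ[K] B} {g₂ : C' →ₗ[K] C} {c : K}

theorem bijective_mapKer (h : f₁ ∘ₗ d₀ = d₀' ∘ₗ f₀) (k : g₁ ∘ₗ d₀' = d₀ ∘ₗ g₀) (hc : c ≠ 0)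
    (hgf : ∀ x ∈ ker d₀, g₀ (f₀ x) = c • x) (hfg : ∀ x ∈ ker d₀', f₀ (g₀ x) = c • x) :
    Bijective (mapKer h) := by
  constructor
  · refine (injective_iff_map_eq_zero _).2 fun x hx => Subtype.ext ?_
    have hx' : f₀ x = 0 := congrArg Subtype.val hx
    have := hgf x x.2
    rw [hx', map_zero] at this
    exact (smul_eq_zero_iff_right hc).1 this.symm
  · intro y
    refine ⟨c⁻¹ • mapKer k y, Subtype.ext ?_⟩
    rw [map_smul]
    change c⁻¹ • f₀ (g₀ y) = y
    rw [hfg y y.2, inv_smul_smul₀ hc]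

theorem bijective_mapCoker (h : f₁ ∘ₗ d₀ = d₀' ∘ₗ f₀) (k : g₁ ∘ₗ d₀' = d₀ ∘ₗ g₀) (hc : c ≠ 0)
    (hgf : ∀ x, g₁ (f₁ x) - c • x ∈ range d₀) (hfg : ∀ x, f₁ (g₁ x) - c • x ∈ range d₀') :
    Bijective (mapCoker h) := by
  constructor
  · refine (injective_iff_map_eq_zero _).2 fun x hx => ?_
    obtain ⟨x, rfl⟩ := Submodule.mkQ_surjective _ x
    obtain ⟨y, hy⟩ : f₁ x ∈ range d₀' := (Submodule.Quotient.mk_eq_zero _).1 hx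
    refine (Submodule.Quotient.mk_eq_zero _).2 (((range d₀).smul_mem_iff hc).1 ?_)
    have e : c • x = d₀ (g₀ y) - (g₁ (f₁ x) - c • x) := by
      rw [← hy, show d₀ (g₀ y) = g₁ (d₀' y) from congr($k y).symm]; abel
    rw [e]
    exact sub_mem (mem_range_self _ _) (hgf x)
  · intro y
    obtain ⟨y, rfl⟩ := Submodule.mkQ_surjective _ y
    refine ⟨c⁻¹ • (range d₀).mkQ (g₁ y), ?_⟩
    rw [map_smul]
    change c⁻¹ • (range d₀').mkQ (f₁ (g₁ y)) = (range d₀').mkQ y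
    rw [inv_smul_eq_iff₀ hc, ← map_smul]
    exact (Submodule.Quotient.eq _).2 (hfg y)

theorem bijective_mapHomology (h₀ : f₁ ∘ₗ d₀ = d₀' ∘ₗ f₀) (h₁ : f₂ ∘ₗ d₁ = d₁' ∘ₗ f₁)
    (k₀ : g₁ ∘ₗ d₀' = d₀ ∘ₗ g₀) (k₁ : g₂ ∘ₗ d₁' = d₁ ∘ₗ g₁) (hc : c ≠ 0)
    (hgf : ∀ x ∈ ker d₁, g₁ (f₁ x) - c • x ∈ range d₀)
    (hfg : ∀ x ∈ ker d₁', f₁ (g₁ x) - c • x ∈ range d₀') :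
    Bijective (mapHomology h₀ h₁) := by
  constructor
  · refine (injective_iff_map_eq_zero _).2 fun x hx => ?_
    obtain ⟨x, rfl⟩ := Submodule.mkQ_surjective _ x
    obtain ⟨y, hy⟩ : mapKer h₁ x ∈ (range d₀').comap (ker d₁').subtype :=
      (Submodule.Quotient.mk_eq_zero _).1 hx
    replace hy : d₀' y = f₁ x := hy
    refine (Submodule.Quotient.mk_eq_zero _).2 (((range d₀).smul_mem_iff hc).1 ?_)
    have e : c • (x : B) = d₀ (g₀ y) - (g₁ (f₁ x) - c • (x : B)) := by
      rw [← hy, show d₀ (g₀ y) = g₁ (d₀' y) from congr($k₀ y).symm]; abel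
    change c • (x : B) ∈ _
    rw [e]
    exact sub_mem (mem_range_self _ _) (hgf x x.2)
  · intro y
    obtain ⟨y, rfl⟩ := Submodule.mkQ_surjective _ y
    refine ⟨c⁻¹ • Submodule.mkQ _ (mapKer k₁ y), ?_⟩
    rw [map_smul]
    change c⁻¹ • Submodule.mkQ _ (mapKer h₁ (mapKer k₁ y)) = _
    rw [inv_smul_eq_iff₀ hc, ← map_smul]
    exact (Submodule.Quotient.eq _).2 (hfg y y.2)

end Complex

end LinearMap

/-! ### Closed ranges and self-adjoint Fredholm operators -/

namespace ContinuousLinearMap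

theorem isClosed_range_of_finite_coker {E F : Type*} [NormedAddCommGroup E] [NormedSpace ℂ E]
    [CompleteSpace E] [NormedAddCommGroup F] [NormedSpace ℂ F] [CompleteSpace F] (f : E →L[ℂ] F)
    (hf : FiniteDimensional ℂ (F ⧸ LinearMap.range (f : E →ₗ[ℂ] F))) :
    IsClosed (Set.range f) := by
  obtain ⟨G, hG⟩ := Submodule.exists_isCompl (LinearMap.range (f : E →ₗ[ℂ] F))
  have : FiniteDimensional ℂ G :=
    (Submodule.quotientEquivOfIsCompl _ _ hG).finiteDimensional
  have : CompleteSpace G := FiniteDimensional.complete ℂ G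
  let g : E × G →L[ℂ] F := f.coprod G.subtypeL
  have hg : Function.Surjective g := fun y => by
    have hy : y ∈ LinearMap.range (f : E →ₗ[ℂ] F) ⊔ G := hG.sup_eq_top ▸ Submodule.mem_top
    obtain ⟨_, ⟨x, rfl⟩, v, hv, rfl⟩ := Submodule.mem_sup.1 hy
    exact ⟨(x, ⟨v, hv⟩), by simp [g]⟩
  -- By the open mapping theorem `g` is a quotient map, so closedness can be tested on the preimage
  -- of the range, which is `E × {0}`.
  rw [← (g.isOpenMap hg).isQuotientMap g.continuous hg |>.isClosed_preimage]
  have : g ⁻¹' Set.range f = Prod.snd ⁻¹' {(0 : G)} := by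
    ext ⟨x, v⟩
    simp only [Set.mem_preimage, Set.mem_singleton_iff, g, coprod_apply, Submodule.subtypeL_apply]
    constructor
    · rintro ⟨y, hy⟩
      have hv : (v : F) ∈ LinearMap.range (f : E →ₗ[ℂ] F) := ⟨y - x, by simp [hy]⟩
      exact Subtype.ext (Submodule.disjoint_def.1 hG.disjoint v hv v.2)
    · rintro rfl
      exact ⟨x, by simp⟩
  rw [this]
  exact isClosed_singleton.preimage continuous_snd

/-- Off the finite-dimensional kernel `W` of `B Q`, the operator `B Q` is bounded below; as `‖B Q x‖
≤ ‖B‖ ‖Q x‖`, so is `Q`. Hence `Q(Wᗮ)` is closed, and adding the finite-dimensional `Q(W)` keeps it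
closed. -/
theorem isClosed_range_of_comp {H F : Type*} [NormedAddCommGroup H] [InnerProductSpace ℂ H]
    [CompleteSpace H] [NormedAddCommGroup F] [NormedSpace ℂ F] [CompleteSpace F]
    (B : H →L[ℂ] F) (Q : H →L[ℂ] H)
    (hker : FiniteDimensional ℂ (LinearMap.ker (B ∘L Q : H →ₗ[ℂ] F)))
    (hcl : IsClosed (Set.range (B ∘L Q))) : IsClosed (Set.range Q) := by
  let W : Submodule ℂ H := LinearMap.ker (B ∘L Q : H →ₗ[ℂ] F)
  have hW : IsCompl W Wᗮ := W.isCompl_orthogonal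
  let u : Wᗮ →L[ℂ] F := (B ∘L Q) ∘L Wᗮ.subtypeL
  have hinj : Function.Injective u := (injective_iff_map_eq_zero u).2 fun x hx =>
    Subtype.ext (Submodule.disjoint_def.1 hW.disjoint x hx x.2)
  have hdec : ∀ x : H, ∃ w ∈ W, ∃ v ∈ Wᗮ, w + v = x := fun x => by
    have hx : x ∈ W ⊔ Wᗮ := hW.sup_eq_top ▸ Submodule.mem_top
    exact Submodule.mem_sup.1 hx
  have hu : Set.range u = Set.range (B ∘L Q) := by
    refine Set.Subset.antisymm (by rintro _ ⟨x, rfl⟩; exact ⟨x, rfl⟩) ?_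
    rintro _ ⟨x, rfl⟩
    obtain ⟨w, hw, v, hv, rfl⟩ := hdec x
    have hw' : (B ∘L Q) w = 0 := hw
    exact ⟨⟨v, hv⟩, by rw [map_add, hw', zero_add]; rfl⟩
  obtain ⟨c, hc⟩ := u.antilipschitz_of_injective_of_isClosed_range hinj (hu ▸ hcl)
  have hcQ : AntilipschitzWith (c * ‖B‖₊) (Q ∘L Wᗮ.subtypeL) := fun x y => by
    refine (hc x y).trans ?_
    rw [ENNReal.coe_mul, mul_assoc]
    gcongr
    exact B.lipschitz _ _
  have hclQ := hcQ.isClosed_range (Q ∘L Wᗮ.subtypeL).uniformContinuous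
  have := Submodule.isClosed_sup_finiteDimensional
    (LinearMap.range (Q ∘L Wᗮ.subtypeL : Wᗮ →ₗ[ℂ] H)) (W.map (Q : H →ₗ[ℂ] H)) hclQ
  convert this
  refine Set.Subset.antisymm ?_ ?_
  · rintro _ ⟨x, rfl⟩
    obtain ⟨w, hw, v, hv, rfl⟩ := hdec x
    rw [add_comm, map_add]
    exact Submodule.add_mem_sup ⟨⟨v, hv⟩, rfl⟩ ⟨w, hw, rfl⟩
  · refine (sup_le ?_ ?_ : _ ≤ LinearMap.range (Q : H →ₗ[ℂ] H))
    · rintro _ ⟨v, rfl⟩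
      exact ⟨v, rfl⟩
    · rintro _ ⟨w, -, rfl⟩
      exact ⟨w, rfl⟩

/-- A closed range is complemented by its orthogonal complement `ker Q* = ker Q`, so the cokernel is
isomorphic to the kernel. -/
theorem isAlgFredholm_of_isSelfAdjoint {H : Type*} [NormedAddCommGroup H] [InnerProductSpace ℂ H]
    [CompleteSpace H] (Q : H →L[ℂ] H) (hQ : adjoint Q = Q)
    (hker : FiniteDimensional ℂ (LinearMap.ker (Q : H →ₗ[ℂ] H))) (hcl : IsClosed (Set.range Q)) :
    (Q : H →ₗ[ℂ] H).IsAlgFredholm := by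
  have : CompleteSpace Q.range := hcl.completeSpace_coe
  have h : IsCompl Q.range Q.ker := by
    have := Submodule.isCompl_orthogonal (K := Q.range)
    rwa [orthogonal_range, hQ] at this
  exact ⟨hker, (Submodule.quotientEquivOfIsCompl _ _ h).symm.finiteDimensional⟩

end ContinuousLinearMap

namespace CommutingPair

/-! ### Comparison of Koszul complexes along an intertwiner -/

section Koszul

variable {H : Type*} [NormedAddCommGroup H] [InnerProductSpace ℂ H]

theorem d₁_comp_d₀_linear (S : CommutingPair H) :
    (S.d₁ : H × H →ₗ[ℂ] H) ∘ₗ (S.d₀ : H →ₗ[ℂ] H × H) = 0 :=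
  LinearMap.ext fun x => congr($(S.d₁_comp_d₀) x)

theorem isFredholm_iff [CompleteSpace H] (S : CommutingPair H) : S.IsFredholm ↔
    FiniteDimensional ℂ S.H₀ ∧ FiniteDimensional ℂ S.H₁ ∧ FiniteDimensional ℂ S.H₂ := by
  refine ⟨fun h => ⟨h.finite_H₀, h.finite_H₁, h.finite_H₂⟩, fun ⟨h₀, h₁, h₂⟩ =>
    ⟨?_, isClosed_range_of_finite_coker _ h₂, h₀, h₁, h₂⟩⟩
  have hZ : IsClosed (S.d₁.ker : Set (H × H)) := S.d₁.isClosed_ker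
  have : CompleteSpace S.d₁.ker := hZ.completeSpace_coe
  -- Corestricted to the Banach space `ker d₁`, the map `d₀` has cokernel `H₁`.
  let D : H →L[ℂ] S.d₁.ker := S.d₀.codRestrict _ fun x => congr($(S.d₁_comp_d₀) x)
  have hD : LinearMap.range (D : H →ₗ[ℂ] S.d₁.ker) =
      (LinearMap.range (S.d₀ : H →ₗ[ℂ] H × H)).comap
        (LinearMap.ker (S.d₁ : H × H →ₗ[ℂ] H)).subtype := LinearMap.range_codRestrict _ _ _
  have hcl := D.isClosed_range_of_finite_coker (by rw [hD]; exact h₁)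
  have := hZ.isClosedEmbedding_subtypeVal.isClosedMap _ hcl
  rwa [← Set.range_comp] at this

variable {S S' : CommutingPair H} {Q : H →L[ℂ] H}

theorem intertwine_d₀ (h₁ : Q * S.fst = S'.fst * Q) (h₂ : Q * S.snd = S'.snd * Q) :
    (Q : H →ₗ[ℂ] H).prodMap (Q : H →ₗ[ℂ] H) ∘ₗ (S.d₀ : H →ₗ[ℂ] H × H) =
      (S'.d₀ : H →ₗ[ℂ] H × H) ∘ₗ (Q : H →ₗ[ℂ] H) :=
  LinearMap.ext fun x => Prod.ext congr($h₁ x) congr($h₂ x)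

theorem intertwine_d₁ (h₁ : Q * S.fst = S'.fst * Q) (h₂ : Q * S.snd = S'.snd * Q) :
    (Q : H →ₗ[ℂ] H) ∘ₗ (S.d₁ : H × H →ₗ[ℂ] H) =
      (S'.d₁ : H × H →ₗ[ℂ] H) ∘ₗ (Q : H →ₗ[ℂ] H).prodMap (Q : H →ₗ[ℂ] H) := by
  refine LinearMap.ext fun x => ?_
  have e₁ : Q (S.fst x.2) = S'.fst (Q x.2) := congr($h₁ x.2)
  have e₂ : Q (S.snd x.1) = S'.snd (Q x.1) := congr($h₂ x.1)
  simp [d₁, e₁, e₂]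

/-- Fredholmness and the index agree for two pairs related by maps on homology that are Fredholm
with vanishing total index. -/
theorem isFredholm_iff_and_index_eq [CompleteSpace H]
    {φ₀ : S.H₀ →ₗ[ℂ] S'.H₀} {φ₁ : S.H₁ →ₗ[ℂ] S'.H₁} {φ₂ : S.H₂ →ₗ[ℂ] S'.H₂}
    (h₀ : φ₀.IsAlgFredholm) (h₁ : φ₁.IsAlgFredholm) (h₂ : φ₂.IsAlgFredholm)
    (hind : φ₀.algIndex - φ₁.algIndex + φ₂.algIndex = 0) :
    (S.IsFredholm ↔ S'.IsFredholm) ∧ (S.IsFredholm → S.index = S'.index) := by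
  have hiff : S.IsFredholm ↔ S'.IsFredholm := by
    rw [isFredholm_iff, isFredholm_iff, h₀.finite_iff, h₁.finite_iff, h₂.finite_iff]
  refine ⟨hiff, fun hS => ?_⟩
  have hS' := hiff.1 hS
  have := hS.finite_H₀
  have := hS.finite_H₁
  have := hS.finite_H₂
  have := hS'.finite_H₀
  have := hS'.finite_H₁
  have := hS'.finite_H₂
  -- Between finite-dimensional spaces each index is a difference of dimensions, so `hind` becomes
  -- the equality of Euler characteristics.
  rw [φ₀.algIndex_of_finiteDimensional, φ₁.algIndex_of_finiteDimensional,
    φ₂.algIndex_of_finiteDimensional] at hind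
  rw [index, index]
  omega

theorem isFredholm_iff_of_intertwine_fredholm [CompleteSpace H]
    (h₁ : Q * S.fst = S'.fst * Q) (h₂ : Q * S.snd = S'.snd * Q)
    (hQ : (Q : H →ₗ[ℂ] H).IsAlgFredholm) :
    (S.IsFredholm ↔ S'.IsFredholm) ∧ (S.IsFredholm → S.index = S'.index) := by
  obtain ⟨hQ₂, hind⟩ := hQ.prodMap_self
  have k₀ := intertwine_d₀ h₁ h₂
  have k₁ := intertwine_d₁ h₁ h₂
  refine isFredholm_iff_and_index_eq (LinearMap.isAlgFredholm_mapKer k₀ hQ hQ₂).1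
    (LinearMap.isAlgFredholm_mapHomology k₀ k₁ S.d₁_comp_d₀_linear S'.d₁_comp_d₀_linear
      hQ hQ₂ hQ).1 (LinearMap.isAlgFredholm_mapCoker k₁ hQ₂ hQ).1 ?_
  rw [LinearMap.algIndex_homology k₀ k₁ S.d₁_comp_d₀_linear S'.d₁_comp_d₀_linear hQ hQ₂ hQ, hind]
  ring

/-- `E` acts as zero on the homology of the Koszul complex of `S`. -/
structure ActsAsZero (S : CommutingPair H) (E : H →L[ℂ] H) : Prop where
  on_H₀ : ∀ x, S.d₀ x = 0 → E x = 0
  on_H₁ : ∀ x y, S.d₁ (x, y) = 0 → (E x, E y) ∈ Set.range S.d₀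
  on_H₂ : ∀ x, E x ∈ Set.range S.d₁

/-- `S₁` is null-homotopic on the Koszul complex: if `S₂ x = S₁ y`, then `(S₁ x, S₁ y) = d₀ x`. -/
theorem actsAsZero_fst (S : CommutingPair H) : S.ActsAsZero S.fst where
  on_H₀ x hx := congrArg Prod.fst hx
  on_H₁ x y h := ⟨x, Prod.ext rfl (by
    simp only [d₁, coprod_apply, neg_apply, neg_add_eq_zero] at h
    exact h)⟩
  on_H₂ x := ⟨(0, x), by simp [d₁]⟩

theorem actsAsZero_snd (S : CommutingPair H) : S.ActsAsZero S.snd where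
  on_H₀ x hx := congrArg Prod.snd hx
  on_H₁ x y h := ⟨y, Prod.ext (by
    simp only [d₁, coprod_apply, neg_apply, neg_add_eq_zero] at h
    exact h.symm) rfl⟩
  on_H₂ x := ⟨(-x, 0), by simp [d₁]⟩

theorem isFredholm_iff_of_intertwine_inverse [CompleteSpace H] {A E E' : H →L[ℂ] H} {c : ℂ}
    (hc : c ≠ 0)
    (h₁ : Q * S.fst = S'.fst * Q) (h₂ : Q * S.snd = S'.snd * Q)
    (k₁ : A * S'.fst = S.fst * A) (k₂ : A * S'.snd = S.snd * A)
    (hE : S.ActsAsZero E) (hE' : S'.ActsAsZero E')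
    (hAQ : A * Q = E + c • 1) (hQA : Q * A = E' + c • 1) :
    (S.IsFredholm ↔ S'.IsFredholm) ∧ (S.IsFredholm → S.index = S'.index) := by
  have hAQ' : ∀ x, A (Q x) = E x + c • x := fun x => congr($hAQ x)
  have hQA' : ∀ x, Q (A x) = E' x + c • x := fun x => congr($hQA x)
  have b₀ := LinearMap.bijective_mapKer (intertwine_d₀ h₁ h₂) (intertwine_d₀ k₁ k₂) hc
    (fun x hx => by
      change A (Q x) = _
      rw [hAQ', hE.on_H₀ x hx, zero_add])
    (fun x hx => by
      change Q (A x) = _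
      rw [hQA', hE'.on_H₀ x hx, zero_add])
  have b₁ := LinearMap.bijective_mapHomology (intertwine_d₀ h₁ h₂) (intertwine_d₁ h₁ h₂)
    (intertwine_d₀ k₁ k₂) (intertwine_d₁ k₁ k₂) hc
    (fun x hx => by
      have h := hE.on_H₁ x.1 x.2 hx
      rw [eq_sub_of_add_eq (hAQ' x.1).symm, eq_sub_of_add_eq (hAQ' x.2).symm] at h
      exact h)
    (fun x hx => by
      have h := hE'.on_H₁ x.1 x.2 hx
      rw [eq_sub_of_add_eq (hQA' x.1).symm, eq_sub_of_add_eq (hQA' x.2).symm] at h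
      exact h)
  have b₂ := LinearMap.bijective_mapCoker (intertwine_d₁ h₁ h₂) (intertwine_d₁ k₁ k₂) hc
    (fun x => by
      convert hE.on_H₂ x using 1
      simp [hAQ'])
    (fun x => by
      convert hE'.on_H₂ x using 1
      simp [hQA'])
  refine isFredholm_iff_and_index_eq (LinearMap.isAlgFredholm_of_bijective b₀)
    (LinearMap.isAlgFredholm_of_bijective b₁) (LinearMap.isAlgFredholm_of_bijective b₂) ?_
  rw [LinearMap.algIndex_of_bijective b₀, LinearMap.algIndex_of_bijective b₁,
    LinearMap.algIndex_of_bijective b₂]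
  rfl

theorem sub_smul_one_intertwine {X Y Z : H →L[ℂ] H} (h : X * Y = Z * X) (c : ℂ) :
    X * (Y - c • 1) = (Z - c • 1) * X := by
  rw [mul_sub, sub_mul, h, mul_smul_comm, smul_mul_assoc, mul_one, one_mul]

theorem translate_zero (S : CommutingPair H) : S.translate 0 = S := by
  ext <;> simp [translate]

end Koszul

/-! ### The spherical Aluthge transform -/

section Aluthge

variable {H : Type*} [NormedAddCommGroup H] [InnerProductSpace ℂ H] [CompleteSpace H]

/-- Meant for `S = T` and for `S` the Aluthge transform: in both cases `d₀` of `S` factors through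
`√P`. -/
theorem isAlgFredholm_sqrtP (T : CommutingPair H) {S : CommutingPair H} {B₁ B₂ : H →L[ℂ] H}
    (h₁ : S.fst = B₁ * T.sqrtP) (h₂ : S.snd = B₂ * T.sqrtP) (hS : S.IsFredholm) :
    (T.sqrtP : H →ₗ[ℂ] H).IsAlgFredholm := by
  have hd : S.d₀ = (B₁.prod B₂) ∘L T.sqrtP := by
    rw [d₀, h₁, h₂]; rfl
  have hker : FiniteDimensional ℂ (LinearMap.ker (S.d₀ : H →ₗ[ℂ] H × H)) := hS.finite_H₀
  have hcl := hS.isClosed_range_d₀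
  rw [hd] at hker hcl
  refine isAlgFredholm_of_isSelfAdjoint _ T.sqrtP_isSelfAdjoint ?_
    (isClosed_range_of_comp _ _ hker hcl)
  refine Submodule.finiteDimensional_of_le (S₂ := LinearMap.ker
    ((B₁.prod B₂) ∘L T.sqrtP : H →ₗ[ℂ] H × H)) fun x hx => ?_
  have hx' : T.sqrtP x = 0 := hx
  simp [hx']

theorem sphericalAluthge_translate (T : CommutingPair H) (l : ℂ × ℂ) :
    ((T.translate l).IsFredholm ↔ (T.sphericalAluthge.translate l).IsFredholm) ∧
      ((T.translate l).IsFredholm →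
        (T.translate l).index = (T.sphericalAluthge.translate l).index) := by
  have hV := T.polar_spec
  have f₁ : T.fst = T.polar.1 * T.sqrtP * T.sqrtP := by
    rw [mul_assoc, T.sqrtP_mul_sqrtP]; exact hV.fst_eq
  have f₂ : T.snd = T.polar.2 * T.sqrtP * T.sqrtP := by
    rw [mul_assoc, T.sqrtP_mul_sqrtP]; exact hV.snd_eq
  have g₁ : T.sphericalAluthge.fst = T.sqrtP * (T.polar.1 * T.sqrtP) := mul_assoc _ _ _
  have g₂ : T.sphericalAluthge.snd = T.sqrtP * (T.polar.2 * T.sqrtP) := mul_assoc _ _ _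
  have hcomm : T.polar.1 * T.sqrtP * T.sqrtP * T.polar.2 =
      T.polar.2 * T.sqrtP * T.sqrtP * T.polar.1 := by
    rw [mul_assoc T.polar.1, mul_assoc T.polar.2, T.sqrtP_mul_sqrtP, T.polar_comm]
  have hcomm' : T.polar.1 * T.sqrtP * (T.sqrtP * (T.polar.2 * T.sqrtP)) =
      T.polar.2 * T.sqrtP * (T.sqrtP * (T.polar.1 * T.sqrtP)) := by
    simp only [← mul_assoc]; rw [hcomm]
  have q₁ : T.sqrtP * T.fst = T.sphericalAluthge.fst * T.sqrtP := by
    rw [f₁, g₁]; simp only [mul_assoc]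
  have q₂ : T.sqrtP * T.snd = T.sphericalAluthge.snd * T.sqrtP := by
    rw [f₂, g₂]; simp only [mul_assoc]
  have q₁' := sub_smul_one_intertwine q₁ l.1
  have q₂' := sub_smul_one_intertwine q₂ l.2
  by_cases hl₁ : l.1 = 0
  · by_cases hl₂ : l.2 = 0
    · obtain rfl : l = 0 := Prod.ext hl₁ hl₂
      rw [translate_zero, translate_zero]
      -- Fredholmness of `√P` stays a hypothesis here: it is obtained from whichever of the two
      -- pairs is assumed Fredholm.
      have key := isFredholm_iff_of_intertwine_fredholm q₁ q₂
      refine ⟨⟨fun h => (key (T.isAlgFredholm_sqrtP f₁ f₂ h)).1.1 h, fun h =>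
        (key (T.isAlgFredholm_sqrtP (S := T.sphericalAluthge) rfl rfl h)).1.2 h⟩,
        fun h => (key (T.isAlgFredholm_sqrtP f₁ f₂ h)).2 h⟩
    · refine isFredholm_iff_of_intertwine_inverse (S := T.translate l)
        (S' := T.sphericalAluthge.translate l) (A := T.polar.2 * T.sqrtP) hl₂ q₁' q₂'
        (sub_smul_one_intertwine ?_ l.1) (sub_smul_one_intertwine ?_ l.2)
        (actsAsZero_snd _) (actsAsZero_snd _) ?_ ?_
      · rw [g₁, f₁, ← hcomm']; simp only [mul_assoc]
      · rw [g₂, f₂]; simp only [mul_assoc]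
      · rw [← f₂]; simp [translate]
      · rw [← g₂]; simp [translate]
  -- With `A = V₁ √P` the composites are `T₁ = (T₁ - λ₁) + λ₁` and `T̂₁ = (T̂₁ - λ₁) + λ₁`, so the
  -- scalar is `λ₁`. Only intertwining the second coordinates needs `V₁ P V₂ = V₂ P V₁`.
  · refine isFredholm_iff_of_intertwine_inverse (S := T.translate l)
      (S' := T.sphericalAluthge.translate l) (A := T.polar.1 * T.sqrtP) hl₁ q₁' q₂'
      (sub_smul_one_intertwine ?_ l.1) (sub_smul_one_intertwine ?_ l.2)
      (actsAsZero_fst _) (actsAsZero_fst _) ?_ ?_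
    · rw [g₁, f₁]; simp only [mul_assoc]
    · rw [g₂, f₂, hcomm']; simp only [mul_assoc]
    · rw [← f₁]; simp [translate]
    · rw [← g₁]; simp [translate]

end Aluthge

end CommutingPair

theorem theorem2p12 {H : Type*} [NormedAddCommGroup H] [InnerProductSpace ℂ H] [CompleteSpace H]
    (T : CommutingPair H) :
    T.essentialSpectrum = T.sphericalAluthge.essentialSpectrum ∧
      ∀ l : ℂ × ℂ, l ∉ T.essentialSpectrum →
        (T.translate l).index = (T.sphericalAluthge.translate l).index :=
  ⟨Set.ext fun l => not_congr (T.sphericalAluthge_translate l).1,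
    fun l hl => (T.sphericalAluthge_translate l).2 (not_not.1 hl)⟩
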